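/- Let $n\ge 1$ and let $\mathcal H_n=\{w=(z,t): z\in\mathbb C^n,\ t\in\mathbb R\}$ be the Heisenberg group, with product $(z,t)(z',t')=(z+z',\,t+t'+2\,\mathrm{Im}\, z\cdot\bar z')$, where $z\cdot\bar z'=\sum_k z_k\bar z'_k$, with Haar measure $dw=4^n\,dx\,dy\,dt$ ($z=x+iy$), and with $|w|=(|z|^4+t^2)^{1/4}$, where $|z|$ is the Euclidean norm. All $L^p$ norms are taken with respect to $dw$, and $*$ is convolution on the group, $(k*g)(w)=\int_{\mathcal H_n} k(v)\,g(v^{-1}w)\,dv$. Let $1<p<\infty$, $1/p+1/p'=1$, $0<\lambda<2n+2$, $\alpha<2n/p$, $\beta<2n/p'$ and $2n+2=\lambda+\alpha+\beta$. Then for every $f\in L^p(\mathcal H_n)$ the integral defining $|w|^{-\lambda}*(|z|^{-\beta}f)$ converges absolutely almost everywhere, the function $|z|^{-\alpha}\big(|w|^{-\lambda}*(|z|^{-\beta}f)\big)$ belongs to $L^p(\mathcal H_n)$, and $$\Big\|\,|z|^{-\alpha}\Big(|w|^{-\lambda}*\big(|z|^{-\beta}f\big)\Big)\Big\|_{L^p(\mathcal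 H_n)}\le D_{\alpha,\beta}\,\|f\|_{L^p(\mathcal H_n)},$$ $$D_{\alpha,\beta}=(4\pi^2)^n\sqrt{\pi}\left[\frac{\Gamma\big(\frac{2n-\alpha-\beta}{4}\big)\,\Gamma\big(\frac{\alpha+\beta}{2}\big)\,\Gamma\big(\frac np-\frac\alpha2\big)\,\Gamma\big(\frac n{p'}-\frac\beta2\big)}{\Gamma\big(\frac{2n+2-\alpha-\beta}{4}\big)\,\Gamma\big(\frac{2n-\alpha-\beta}{2}\big)\,\Gamma\big(\frac n{p'}+\frac\alpha2\big)\,\Gamma\big(\frac np+\frac\beta2\big)}\right].$$ -/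

import Mathlib

open MeasureTheory
open scoped ENNReal

/-- The Heisenberg group `H_n`, with underlying space `ℂⁿ × ℝ`. A point is `w = (z, t)`. -/
def Heisenberg (n : ℕ) : Type := EuclideanSpace ℂ (Fin n) × ℝ

namespace Heisenberg

/-- The component `z ∈ ℂⁿ` of `w = (z, t)`; its norm `‖w.z‖` is the Euclidean one. -/
def z {n : ℕ} (w : Heisenberg n) : EuclideanSpace ℂ (Fin n) := w.1

/-- The component `t ∈ ℝ` of `w = (z, t)`. -/
def t {n : ℕ} (w : Heisenberg n) : ℝ := w.2

/-- The point `(z, t)`. -/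
def mk {n : ℕ} (z : EuclideanSpace ℂ (Fin n)) (t : ℝ) : Heisenberg n := (z, t)

@[ext] theorem ext {n : ℕ} {v w : Heisenberg n} (hz : v.z = w.z) (ht : v.t = w.t) : v = w :=
  Prod.ext hz ht

/-- The product topology of `ℂⁿ × ℝ`. -/
noncomputable instance (n : ℕ) : TopologicalSpace (Heisenberg n) :=
  inferInstanceAs (TopologicalSpace (EuclideanSpace ℂ (Fin n) × ℝ))

/-- The product (equivalently, Borel) measurable structure of `ℂⁿ × ℝ`. -/
noncomputable instance (n : ℕ) : MeasurableSpace (Heisenberg n) :=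
  inferInstanceAs (MeasurableSpace (EuclideanSpace ℂ (Fin n) × ℝ))

instance (n : ℕ) : BorelSpace (Heisenberg n) :=
  inferInstanceAs (BorelSpace (EuclideanSpace ℂ (Fin n) × ℝ))

/-- The group law `(z, t) (z', t') = (z + z', t + t' + 2 Im (z · conj z'))`. -/
instance (n : ℕ) : Mul (Heisenberg n) where
  mul v w := mk (v.z + w.z) (v.t + w.t + 2 * (∑ k, v.z k * starRingEnd ℂ (w.z k)).im)

instance (n : ℕ) : One (Heisenberg n) where
  one := mk 0 0

instance (n : ℕ) : Inv (Heisenberg n) where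
  inv w := mk (-w.z) (-w.t)

@[simp] theorem mul_z {n : ℕ} (v w : Heisenberg n) : (v * w).z = v.z + w.z := rfl

@[simp] theorem mul_t {n : ℕ} (v w : Heisenberg n) :
    (v * w).t = v.t + w.t + 2 * (∑ k, v.z k * starRingEnd ℂ (w.z k)).im := rfl

@[simp] theorem one_z {n : ℕ} : (1 : Heisenberg n).z = 0 := rfl

@[simp] theorem one_t {n : ℕ} : (1 : Heisenberg n).t = 0 := rfl

@[simp] theorem inv_z {n : ℕ} (w : Heisenberg n) : (w⁻¹).z = -w.z := rfl

@[simp] theorem inv_t {n : ℕ} (w : Heisenberg n) : (w⁻¹).t = -w.t := rfl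

instance (n : ℕ) : Group (Heisenberg n) :=
  Group.ofLeftAxioms
    (by
      intro a b c
      ext1
      · simp [add_assoc]
      · simp [add_mul, mul_add, Finset.sum_add_distrib]
        ring)
    (by
      intro a
      ext1 <;> simp)
    (by
      intro a
      ext1
      · simp
      · simp [Complex.mul_conj, ← Complex.ofReal_sum])

/-- The Haar measure `dw = dz dz̄ dt = 4ⁿ dx dy dt`, where `z = x + i y` and `dx dy` is Lebesgue
measure on `ℂⁿ = ℝ²ⁿ`. -/
noncomputable def haar (n : ℕ) : Measure (Heisenberg n) :=
  (4 : ℝ≥0∞) ^ n • (volume : Measure (EuclideanSpace ℂ (Fin n) × ℝ))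

/-- The homogeneous norm `|w| = (|z|⁴ + t²)^{1/4}`. -/
noncomputable def gauge {n : ℕ} (w : Heisenberg n) : ℝ :=
  (‖w.z‖ ^ 4 + w.t ^ 2) ^ (1 / 4 : ℝ)

/-- Convolution on the group, `(k * g)(w) = ∫ k(v) g(v⁻¹ w) dv`. -/
noncomputable def conv {n : ℕ} (k : Heisenberg n → ℝ) (g : Heisenberg n → ℂ)
    (w : Heisenberg n) : ℂ :=
  ∫ v, k v • g (v⁻¹ * w) ∂(haar n)

/-- The integral that defines `(k * g)(w)` converges absolutely. -/
def ConvExistsAt {n : ℕ} (k : Heisenberg n → ℝ) (g : Heisenberg n → ℂ)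
    (w : Heisenberg n) : Prop :=
  Integrable (fun v => k v • g (v⁻¹ * w)) (haar n)

/-- The kernel `|w|^{-lam}`. -/
noncomputable def kernel (n : ℕ) (lam : ℝ) (w : Heisenberg n) : ℝ :=
  w.gauge ^ (-lam)

/-- Multiplication by the weight: `w = (z, t) ↦ |z|^{-a} g(w)`. -/
noncomputable def weighted {n : ℕ} (a : ℝ) (g : Heisenberg n → ℂ) (w : Heisenberg n) : ℂ :=
  ‖w.z‖ ^ (-a) • g w

/-- The Stein–Weiss operator `f ↦ |z|^{-α} (|w|^{-lam} * (|z|^{-β} f))`. -/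
noncomputable def steinWeiss {n : ℕ} (lam α β : ℝ) (f : Heisenberg n → ℂ) :
    Heisenberg n → ℂ :=
  weighted α (conv (kernel n lam) (weighted β f))

/-- The constant `D_{α,β}`; `q` is the exponent dual to `p`. -/
noncomputable def steinWeissConst (n : ℕ) (p q α β : ℝ) : ℝ :=
  (4 * Real.pi ^ 2) ^ n * √Real.pi *
    ((Real.Gamma ((2 * n - α - β) / 4) * Real.Gamma ((α + β) / 2) *
        Real.Gamma (n / p - α / 2) * Real.Gamma (n / q - β / 2)) /
      (Real.Gamma ((2 * n + 2 - α - β) / 4) * Real.Gamma ((2 * n - α - β) / 2) *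
        Real.Gamma (n / q + α / 2) * Real.Gamma (n / p + β / 2)))

end Heisenberg

/-! The operator has the positive kernel `|w.z|^{-α} |w u⁻¹|^{-lam} |u.z|^{-β}`, so it suffices to
bound it on nonnegative functions, which Schur's test does with power weights depending on `z`
alone. Against such a weight the kernel integral is explicit. Integration along the centre removes
`t` together with the symplectic term and turns `|w u⁻¹|^{-lam}` into a multiple of `|z - z'|^{-(lam
- 2)}`. What remains is a Riesz composition integral on `ℂⁿ = ℝ²ⁿ`, which is again a power of `|z|`.
With `lam = 2A + 2` and both Schur weights equal to `|z|^{-2n/(pq)}`, homogeneity makes each Schur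
condition an equality. The two constants coincide by a reflection symmetry of the composition
constant, and the common value is the claimed constant divided by `π^n`. The argument rests on
`lintegral_add_sq_rpow` (central integral), `lintegral_norm_sub_rpow_mul_norm_rpow` (composition),
`lintegral_rpow_lintegral_mul_le_of_schur` and `schurConst_reflect`. Working with `∫⁻` lets Tonelli
apply without integrability checks. -/

section Integrals

/-! ### Gamma, Beta and Gaussian integrals; the Riesz composition formula -/

theorem lintegral_ofReal_mul_rpow_mul_exp {k u c : ℝ} (hk : 0 ≤ k) (hu : 0 < u) (hc : 0 < c) :
    ∫⁻ r in Set.Ioi (0 : ℝ), ENNReal.ofReal (k * (r ^ (u - 1) * Real.exp (-(c * r)))) =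
      ENNReal.ofReal (k * (Real.Gamma u * c ^ (-u))) := by
  have hint : IntegrableOn (fun r : ℝ => r ^ (u - 1) * Real.exp (-(c * r))) (Set.Ioi 0) := by
    have := integrableOn_rpow_mul_exp_neg_mul_rpow (p := 1) (s := u - 1) (b := c)
      (by linarith) one_pos hc
    simpa using this
  rw [← ofReal_integral_eq_lintegral_ofReal (hint.const_mul k), integral_const_mul,
    Real.integral_rpow_mul_exp_neg_mul_Ioi hu hc, one_div, Real.inv_rpow hc.le,
    ← Real.rpow_neg hc.le, mul_comm (Real.Gamma u)]
  filter_upwards [ae_restrict_mem measurableSet_Ioi] with r hr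
  have hr' : (0 : ℝ) < r := hr
  simp only [Pi.zero_apply]
  positivity

/-- Writing `Γ(u+v) (1+r)^{-(u+v)}` as a Gamma integral in `s` and exchanging the order leaves two
Gamma integrals. -/
theorem lintegral_rpow_mul_one_add_rpow {u v : ℝ} (hu : 0 < u) (hv : 0 < v) :
    ∫⁻ r in Set.Ioi (0 : ℝ), ENNReal.ofReal (r ^ (u - 1) * (1 + r) ^ (-(u + v))) =
      ENNReal.ofReal (Real.Gamma u * Real.Gamma v / Real.Gamma (u + v)) := by
  have huv : 0 < u + v := by positivity
  have hG := Real.Gamma_pos_of_pos huv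
  have hGu := Real.Gamma_pos_of_pos hu
  have hGv := Real.Gamma_pos_of_pos hv
  have key : ENNReal.ofReal (Real.Gamma (u + v)) *
      ∫⁻ r in Set.Ioi (0 : ℝ), ENNReal.ofReal (r ^ (u - 1) * (1 + r) ^ (-(u + v))) =
      ENNReal.ofReal (Real.Gamma u * Real.Gamma v) := by
    calc
      _ = ∫⁻ r in Set.Ioi (0 : ℝ), ∫⁻ s in Set.Ioi (0 : ℝ),
          ENNReal.ofReal (r ^ (u - 1) * (s ^ (u + v - 1) * Real.exp (-((1 + r) * s)))) := by
        rw [← lintegral_const_mul _ (by fun_prop)]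
        refine setLIntegral_congr_fun measurableSet_Ioi fun r hr => ?_
        have hr' : (0 : ℝ) < r := hr
        rw [lintegral_ofReal_mul_rpow_mul_exp (by positivity) huv (by positivity),
          ← ENNReal.ofReal_mul hG.le]
        congr 1
        ring
      _ = ∫⁻ s in Set.Ioi (0 : ℝ), ∫⁻ r in Set.Ioi (0 : ℝ),
          ENNReal.ofReal (r ^ (u - 1) * (s ^ (u + v - 1) * Real.exp (-((1 + r) * s)))) :=
        lintegral_lintegral_swap (by fun_prop)
      _ = ∫⁻ s in Set.Ioi (0 : ℝ),
          ENNReal.ofReal (Real.Gamma u * (s ^ (v - 1) * Real.exp (-(1 * s)))) := by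
        refine setLIntegral_congr_fun measurableSet_Ioi fun s hs => ?_
        have hs' : (0 : ℝ) < s := hs
        have := lintegral_ofReal_mul_rpow_mul_exp (k := s ^ (u + v - 1) * Real.exp (-s))
          (by positivity) hu hs'
        calc
          _ = ∫⁻ r in Set.Ioi (0 : ℝ), ENNReal.ofReal (s ^ (u + v - 1) * Real.exp (-s) *
              (r ^ (u - 1) * Real.exp (-(s * r)))) := by
            refine lintegral_congr fun r => ?_
            rw [show -((1 + r) * s) = -s + -(s * r) by ring, Real.exp_add]
            congr 1
            ring
          _ = _ := by
            rw [this, show u + v - 1 = (v - 1) + u by ring, Real.rpow_add hs',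
              Real.rpow_neg hs'.le, one_mul]
            congr 1
            field_simp
      _ = _ := by
        rw [lintegral_ofReal_mul_rpow_mul_exp hGu.le hv one_pos]
        simp
  rw [ENNReal.ofReal_div_of_pos hG, ENNReal.eq_div_iff (by simpa using hG) ENNReal.ofReal_ne_top,
    key]

theorem lintegral_ofReal_mul_exp_neg_mul_sq {k b : ℝ} (hk : 0 ≤ k) (hb : 0 < b) :
    ∫⁻ s : ℝ, ENNReal.ofReal (k * Real.exp (-b * s ^ 2)) =
      ENNReal.ofReal (k * √(Real.pi / b)) := by
  rw [← ofReal_integral_eq_lintegral_ofReal ((integrable_exp_neg_mul_sq hb).const_mul k),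
    integral_const_mul, integral_gaussian]
  exact Filter.Eventually.of_forall fun s => by simp only [Pi.zero_apply]; positivity

/-- Subordination: `(P + s²)^{-κ}` is a superposition of Gaussians in `s`. The Gaussian integral
costs `r^{-1/2}`, which shifts the Gamma exponent from `κ` to `κ - 1/2`. -/
theorem lintegral_add_sq_rpow {P κ : ℝ} (hP : 0 < P) (hκ : 1 / 2 < κ) :
    ∫⁻ s : ℝ, ENNReal.ofReal ((P + s ^ 2) ^ (-κ)) =
      ENNReal.ofReal (√Real.pi * Real.Gamma (κ - 1 / 2) / Real.Gamma κ * P ^ (1 / 2 - κ)) := by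
  have hκ0 : 0 < κ := by linarith
  have hG := Real.Gamma_pos_of_pos hκ0
  have key : ENNReal.ofReal (Real.Gamma κ) * ∫⁻ s : ℝ, ENNReal.ofReal ((P + s ^ 2) ^ (-κ)) =
      ENNReal.ofReal (√Real.pi * (Real.Gamma (κ - 1 / 2) * P ^ (-(κ - 1 / 2)))) := by
    calc
      _ = ∫⁻ s : ℝ, ∫⁻ r in Set.Ioi (0 : ℝ),
          ENNReal.ofReal (1 * (r ^ (κ - 1) * Real.exp (-((P + s ^ 2) * r)))) := by
        rw [← lintegral_const_mul _ (by fun_prop)]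
        refine lintegral_congr fun s => ?_
        rw [lintegral_ofReal_mul_rpow_mul_exp zero_le_one hκ0 (by positivity),
          ← ENNReal.ofReal_mul hG.le, one_mul]
      _ = ∫⁻ r in Set.Ioi (0 : ℝ), ∫⁻ s : ℝ,
          ENNReal.ofReal (1 * (r ^ (κ - 1) * Real.exp (-((P + s ^ 2) * r)))) :=
        lintegral_lintegral_swap (by fun_prop)
      _ = ∫⁻ r in Set.Ioi (0 : ℝ),
          ENNReal.ofReal (√Real.pi * (r ^ (κ - 1 / 2 - 1) * Real.exp (-(P * r)))) := by
        refine setLIntegral_congr_fun measurableSet_Ioi fun r hr => ?_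
        have hr' : (0 : ℝ) < r := hr
        calc
          _ = ∫⁻ s : ℝ, ENNReal.ofReal (r ^ (κ - 1) * Real.exp (-(P * r)) *
              Real.exp (-r * s ^ 2)) := by
            refine lintegral_congr fun s => ?_
            rw [show -((P + s ^ 2) * r) = -(P * r) + -r * s ^ 2 by ring, Real.exp_add]
            congr 1
            ring
          _ = _ := by
            have h : r ^ (κ - 1 / 2 - 1) = r ^ (κ - 1) / r ^ (1 / 2 : ℝ) := by
              rw [← Real.rpow_sub hr']
              ring_nf
            rw [lintegral_ofReal_mul_exp_neg_mul_sq (by positivity) hr',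
              Real.sqrt_div Real.pi_pos.le, Real.sqrt_eq_rpow r, h]
            congr 1
            ring
      _ = _ := lintegral_ofReal_mul_rpow_mul_exp (Real.sqrt_nonneg _) (by linarith) hP
  rw [neg_sub] at key
  rw [div_mul_eq_mul_div, ENNReal.ofReal_div_of_pos hG,
    ENNReal.eq_div_iff (by simpa using hG) ENNReal.ofReal_ne_top, key, mul_assoc]

theorem lintegral_Ioi_comp_mul_left {t : ℝ} (ht : 0 < t) (g : ℝ → ℝ≥0∞) (hg : Measurable g) :
    ∫⁻ s in Set.Ioi (0 : ℝ), g s = ∫⁻ r in Set.Ioi (0 : ℝ), ENNReal.ofReal t * g (t * r) := by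
  rw [lintegral_const_mul _ (by fun_prop), ← lintegral_indicator measurableSet_Ioi,
    ← lintegral_indicator measurableSet_Ioi]
  conv_lhs => rw [← Real.smul_map_volume_mul_left ht.ne']
  rw [lintegral_smul_measure, lintegral_map (hg.indicator measurableSet_Ioi) (by fun_prop),
    abs_of_pos ht, smul_eq_mul]
  congr 1
  refine lintegral_congr fun r => ?_
  simp [Set.indicator, ht]

variable {V : Type*} [NormedAddCommGroup V] [InnerProductSpace ℝ V]

theorem mul_norm_sub_sq_add_mul_norm_sq {s t : ℝ} (h : s + t ≠ 0) (x y : V) :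
    s * ‖x - y‖ ^ 2 + t * ‖y‖ ^ 2 =
      (s + t) * ‖y - (s / (s + t)) • x‖ ^ 2 + s * t / (s + t) * ‖x‖ ^ 2 := by
  rw [norm_sub_sq_real, norm_sub_sq_real, norm_smul, inner_smul_right, real_inner_comm y x,
    mul_pow, Real.norm_eq_abs, sq_abs]
  field_simp
  ring

variable [FiniteDimensional ℝ V] [MeasurableSpace V] [BorelSpace V]

theorem lintegral_ofReal_mul_exp_neg_norm_sub_sq {k s t : ℝ} (hk : 0 ≤ k) (hs : 0 < s)
    (ht : 0 < t) (x : V) :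
    ∫⁻ y : V, ENNReal.ofReal (k * Real.exp (-(s * ‖x - y‖ ^ 2 + t * ‖y‖ ^ 2))) =
      ENNReal.ofReal (k * ((Real.pi / (s + t)) ^ ((Module.finrank ℝ V : ℝ) / 2) *
        Real.exp (-(s * t / (s + t) * ‖x‖ ^ 2)))) := by
  have hst : 0 < s + t := by positivity
  have hint : Integrable (fun y : V => Real.exp (-(s + t) * ‖y‖ ^ 2)) := by
    have h := GaussianFourier.integrable_cexp_neg_mul_sq_norm_add (V := V) (b := ((s + t : ℝ) : ℂ))
      (by simpa using hst) 0 0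
    refine h.norm.congr (Filter.Eventually.of_forall fun y => ?_)
    simp only [zero_mul, add_zero, Complex.norm_exp]
    congr 1
    norm_cast
  calc
    _ = ∫⁻ y : V, ENNReal.ofReal (k * Real.exp (-(s * t / (s + t) * ‖x‖ ^ 2)) *
        Real.exp (-(s + t) * ‖y - (s / (s + t)) • x‖ ^ 2)) := by
      refine lintegral_congr fun y => ?_
      rw [mul_norm_sub_sq_add_mul_norm_sq hst.ne', neg_add, Real.exp_add, neg_mul]
      congr 1
      ring
    _ = ∫⁻ y : V, ENNReal.ofReal (k * Real.exp (-(s * t / (s + t) * ‖x‖ ^ 2)) *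
        Real.exp (-(s + t) * ‖y‖ ^ 2)) :=
      lintegral_sub_right_eq_self (μ := volume) (fun y : V =>
        ENNReal.ofReal (k * Real.exp (-(s * t / (s + t) * ‖x‖ ^ 2)) *
          Real.exp (-(s + t) * ‖y‖ ^ 2))) _
    _ = _ := by
      rw [← ofReal_integral_eq_lintegral_ofReal (hint.const_mul _), integral_const_mul,
        GaussianFourier.integral_rexp_neg_mul_sq_norm hst]
      · congr 1
        ring
      · exact Filter.Eventually.of_forall fun s => by simp only [Pi.zero_apply]; positivity

/-- Both powers are written as Gamma integrals of Gaussians, so that the `y`-integral becomes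
Gaussian; a Gamma and a Beta integral remain. The conditions `A < D` and `B < D` give convergence at
the two singularities, `D < A + B` at infinity. -/
theorem lintegral_norm_sub_rpow_mul_norm_rpow [Nontrivial V] {A B D : ℝ}
    (hD : D = (Module.finrank ℝ V : ℝ) / 2) (hA : 0 < A)
    (hB : 0 < B) (hAD : A < D) (hBD : B < D) (hAB : D < A + B) {x : V} (hx : x ≠ 0) :
    ∫⁻ y : V, ENNReal.ofReal (‖x - y‖ ^ (-(2 * A)) * ‖y‖ ^ (-(2 * B))) =
      ENNReal.ofReal (Real.pi ^ D * (Real.Gamma (D - A) * Real.Gamma (D - B) *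
        Real.Gamma (A + B - D)) / (Real.Gamma A * Real.Gamma B * Real.Gamma (2 * D - A - B)) *
        ‖x‖ ^ (-(2 * (A + B - D)))) := by
  have hGA := Real.Gamma_pos_of_pos hA
  have hGB := Real.Gamma_pos_of_pos hB
  have hGE := Real.Gamma_pos_of_pos (sub_pos.2 hAB)
  have hx' : 0 < ‖x‖ := norm_pos_iff.2 hx
  have hpi := Real.pi_pos
  have key : ENNReal.ofReal (Real.Gamma A * Real.Gamma B) *
      ∫⁻ y : V, ENNReal.ofReal (‖x - y‖ ^ (-(2 * A)) * ‖y‖ ^ (-(2 * B))) =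
      ENNReal.ofReal (Real.pi ^ D * Real.Gamma (A + B - D) * ‖x‖ ^ (-(2 * (A + B - D)))) *
        ENNReal.ofReal (Real.Gamma (D - B) * Real.Gamma (D - A) /
          Real.Gamma ((D - B) + (D - A))) := by
    calc
      _ = ∫⁻ y : V, ∫⁻ t in Set.Ioi (0 : ℝ), ∫⁻ s in Set.Ioi (0 : ℝ),
          ENNReal.ofReal (s ^ (A - 1) * t ^ (B - 1) *
            Real.exp (-(s * ‖x - y‖ ^ 2 + t * ‖y‖ ^ 2))) := by
        rw [← lintegral_const_mul _ (by fun_prop)]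
        have hne : ∀ a : V, ∀ᵐ y : V, y ≠ a := fun a => by
          simp [ae_iff]
        refine lintegral_congr_ae ?_
        filter_upwards [hne 0, hne x] with y hy0 hyx
        have hy0' : 0 < ‖y‖ := norm_pos_iff.2 hy0
        have hyx' : 0 < ‖x - y‖ := norm_pos_iff.2 (sub_ne_zero.2 hyx.symm)
        symm
        calc
          _ = ∫⁻ t in Set.Ioi (0 : ℝ), ENNReal.ofReal (Real.Gamma A * ‖x - y‖ ^ (-(2 * A)) *
              (t ^ (B - 1) * Real.exp (-(‖y‖ ^ 2 * t)))) := by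
            refine setLIntegral_congr_fun measurableSet_Ioi fun t ht => ?_
            have ht' : (0 : ℝ) < t := ht
            have := lintegral_ofReal_mul_rpow_mul_exp
              (k := t ^ (B - 1) * Real.exp (-(‖y‖ ^ 2 * t)))
              (by positivity) hA (c := ‖x - y‖ ^ 2) (by positivity)
            calc
              _ = ∫⁻ s in Set.Ioi (0 : ℝ), ENNReal.ofReal
                  ((t ^ (B - 1) * Real.exp (-(‖y‖ ^ 2 * t))) *
                    (s ^ (A - 1) * Real.exp (-(‖x - y‖ ^ 2 * s)))) := by
                refine lintegral_congr fun s => ?_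
                rw [show -(s * ‖x - y‖ ^ 2 + t * ‖y‖ ^ 2) =
                  -(‖y‖ ^ 2 * t) + -(‖x - y‖ ^ 2 * s) by ring, Real.exp_add]
                congr 1
                ring
              _ = _ := by
                rw [this, ← Real.rpow_natCast_mul hyx'.le]
                congr 1
                push_cast
                ring_nf
          _ = _ := by
            rw [lintegral_ofReal_mul_rpow_mul_exp (by positivity) hB (by positivity),
              ← Real.rpow_natCast_mul hy0'.le, ← ENNReal.ofReal_mul (by positivity)]
            congr 1
            push_cast
            ring_nf
      _ = ∫⁻ t in Set.Ioi (0 : ℝ), ∫⁻ s in Set.Ioi (0 : ℝ), ∫⁻ y : V,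
          ENNReal.ofReal (s ^ (A - 1) * t ^ (B - 1) *
            Real.exp (-(s * ‖x - y‖ ^ 2 + t * ‖y‖ ^ 2))) := by
        rw [lintegral_lintegral_swap]
        · refine lintegral_congr fun t => ?_
          rw [lintegral_lintegral_swap]
          fun_prop
        · refine Measurable.aemeasurable ?_
          refine Measurable.lintegral_prod_right' (f := fun q : (V × ℝ) × ℝ =>
            ENNReal.ofReal (q.2 ^ (A - 1) * q.1.2 ^ (B - 1) *
            Real.exp (-(q.2 * ‖x - q.1.1‖ ^ 2 + q.1.2 * ‖q.1.1‖ ^ 2)))) ?_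
          fun_prop
      _ = ∫⁻ t in Set.Ioi (0 : ℝ), ∫⁻ s in Set.Ioi (0 : ℝ),
          ENNReal.ofReal (s ^ (A - 1) * t ^ (B - 1) * ((Real.pi / (s + t)) ^ D *
            Real.exp (-(s * t / (s + t) * ‖x‖ ^ 2)))) := by
        refine setLIntegral_congr_fun measurableSet_Ioi fun t ht => ?_
        refine setLIntegral_congr_fun measurableSet_Ioi fun s hs => ?_
        have ht' : (0 : ℝ) < t := ht
        have hs' : (0 : ℝ) < s := hs
        rw [lintegral_ofReal_mul_exp_neg_norm_sub_sq (by positivity) hs' ht', hD]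
      _ = ∫⁻ t in Set.Ioi (0 : ℝ), ∫⁻ r in Set.Ioi (0 : ℝ),
          ENNReal.ofReal (r ^ (A - 1) * (1 + r) ^ (-D) * Real.pi ^ D *
            (t ^ (A + B - D - 1) * Real.exp (-((r * ‖x‖ ^ 2 / (1 + r)) * t)))) := by
        refine setLIntegral_congr_fun measurableSet_Ioi fun t ht => ?_
        have ht' : (0 : ℝ) < t := ht
        -- The substitution `s = t r` turns `st/(s+t)` into `t r/(1+r)`, linear in `t`, so the
        -- `t`-integral is a Gamma integral.
        rw [lintegral_Ioi_comp_mul_left ht' _ (by fun_prop)]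
        refine setLIntegral_congr_fun measurableSet_Ioi fun r hr => ?_
        have hr' : (0 : ℝ) < r := hr
        rw [← ENNReal.ofReal_mul ht'.le]
        congr 1
        have h : t ^ (A + B - D - 1) = t * (t ^ (A - 1) * t ^ (B - 1)) / t ^ D := by
          nth_rewrite 2 [← Real.rpow_one t]
          rw [← Real.rpow_add ht', ← Real.rpow_add ht', ← Real.rpow_sub ht']
          ring_nf
        rw [show t * r + t = t * (1 + r) by ring,
          show t * r * t / (t * (1 + r)) * ‖x‖ ^ 2 = r * ‖x‖ ^ 2 / (1 + r) * t by field_simp,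
          Real.div_rpow hpi.le (by positivity), Real.mul_rpow ht'.le hr'.le,
          Real.mul_rpow ht'.le (by positivity), Real.rpow_neg (by positivity), h]
        field_simp
      _ = ∫⁻ r in Set.Ioi (0 : ℝ), ∫⁻ t in Set.Ioi (0 : ℝ),
          ENNReal.ofReal (r ^ (A - 1) * (1 + r) ^ (-D) * Real.pi ^ D *
            (t ^ (A + B - D - 1) * Real.exp (-((r * ‖x‖ ^ 2 / (1 + r)) * t)))) :=
        lintegral_lintegral_swap (by fun_prop)
      _ = ∫⁻ r in Set.Ioi (0 : ℝ),
          ENNReal.ofReal (Real.pi ^ D * Real.Gamma (A + B - D) * ‖x‖ ^ (-(2 * (A + B - D)))) *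
            ENNReal.ofReal (r ^ (D - B - 1) * (1 + r) ^ (-((D - B) + (D - A)))) := by
        refine setLIntegral_congr_fun measurableSet_Ioi fun r hr => ?_
        have hr' : (0 : ℝ) < r := hr
        have h1r : 0 < 1 + r := by positivity
        rw [lintegral_ofReal_mul_rpow_mul_exp (by positivity) (by linarith) (by positivity),
          ← ENNReal.ofReal_mul (by positivity)]
        congr 1
        rw [Real.div_rpow (by positivity) h1r.le, Real.mul_rpow hr'.le (by positivity),
          ← Real.rpow_natCast_mul hx'.le,
          show -(D - B + (D - A)) = -D - -(A + B - D) by ring, Real.rpow_sub h1r,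
          show D - B - 1 = (A - 1) + -(A + B - D) by ring, Real.rpow_add hr']
        push_cast
        rw [show 2 * -(A + B - D) = -(2 * (A + B - D)) by ring]
        ring
      _ = _ := by
        rw [lintegral_const_mul _ (by fun_prop),
          lintegral_rpow_mul_one_add_rpow (by linarith) (by linarith)]
  have hG : 0 < Real.Gamma A * Real.Gamma B := by positivity
  rw [← ENNReal.ofReal_mul (by positivity), show D - B + (D - A) = 2 * D - A - B by ring] at key
  rw [← ENNReal.mul_right_inj (a := ENNReal.ofReal (Real.Gamma A * Real.Gamma B))
    (by simpa using hG) ENNReal.ofReal_ne_top, key, ← ENNReal.ofReal_mul hG.le]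
  congr 1
  field_simp

end Integrals

/-- Schur's test with weights. -/
theorem lintegral_rpow_lintegral_mul_le_of_schur {X Y : Type*} [MeasurableSpace X]
    [MeasurableSpace Y] {μ : Measure X} {ν : Measure Y} [SFinite μ] [SFinite ν] {p q : ℝ}
    (hpq : p.HolderConjugate q) {K : X → Y → ℝ≥0∞} (hK : Measurable (Function.uncurry K))
    {h₁ : X → ℝ≥0∞} (hh₁ : Measurable h₁) {h₂ : Y → ℝ≥0∞} (hh₂ : Measurable h₂)
    (h₂_pos : ∀ᵐ y ∂ν, h₂ y ≠ 0) (h₂_fin : ∀ᵐ y ∂ν, h₂ y ≠ ∞) {C : ℝ≥0∞}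
    (H₁ : ∀ᵐ x ∂μ, ∫⁻ y, K x y * h₂ y ^ q ∂ν ≤ C * h₁ x ^ q)
    (H₂ : ∀ᵐ y ∂ν, ∫⁻ x, K x y * h₁ x ^ p ∂μ ≤ C * h₂ y ^ p)
    {g : Y → ℝ≥0∞} (hg : Measurable g) :
    ∫⁻ x, (∫⁻ y, K x y * g y ∂ν) ^ p ∂μ ≤ C ^ p * ∫⁻ y, g y ^ p ∂ν := by
  have hp := hpq.pos
  have hq := hpq.symm.pos
  have hinv : 1 / q + 1 / p = 1 := by
    simpa [one_div, add_comm] using hpq.inv_add_inv_eq_one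
  have hKx : ∀ x, Measurable (K x) := fun x => hK.comp measurable_prodMk_left
  have step : ∀ᵐ x ∂μ, (∫⁻ y, K x y * g y ∂ν) ^ p ≤
      C ^ (p / q) * ∫⁻ y, h₁ x ^ p * (K x y * ((h₂ y)⁻¹ ^ p * g y ^ p)) ∂ν := by
    filter_upwards [H₁] with x hx
    have hm := hKx x
    -- Insert `h₂ · h₂⁻¹` and split `K = K^{1/q} K^{1/p}`, so that the first Hölder factor is
    -- exactly the integral controlled by `H₁`.
    have hsplit : ∫⁻ y, K x y * g y ∂ν =
        ∫⁻ y, ((fun y => K x y ^ (1 / q) * h₂ y) *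
          fun y => K x y ^ (1 / p) * ((h₂ y)⁻¹ * g y)) y ∂ν := by
      refine lintegral_congr_ae ?_
      filter_upwards [h₂_pos, h₂_fin] with y hy0 hyt
      have hKK : K x y ^ (1 / q) * K x y ^ (1 / p) = K x y := by
        rw [← ENNReal.rpow_add_of_nonneg _ _ (by positivity) (by positivity), hinv,
          ENNReal.rpow_one]
      simp only [Pi.mul_apply]
      calc
        _ = (K x y ^ (1 / q) * K x y ^ (1 / p)) * (h₂ y * (h₂ y)⁻¹) * g y := by
          rw [hKK, ENNReal.mul_inv_cancel hy0 hyt, mul_one]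
        _ = _ := by ring
    have hH := ENNReal.lintegral_mul_le_Lp_mul_Lq ν hpq.symm
      (f := fun y => K x y ^ (1 / q) * h₂ y) (g := fun y => K x y ^ (1 / p) * ((h₂ y)⁻¹ * g y))
      (by fun_prop) (by fun_prop)
    rw [← hsplit] at hH
    have e₁ : ∫⁻ y, (K x y ^ (1 / q) * h₂ y) ^ q ∂ν = ∫⁻ y, K x y * h₂ y ^ q ∂ν := by
      refine lintegral_congr fun y => ?_
      rw [ENNReal.mul_rpow_of_nonneg _ _ hq.le, ← ENNReal.rpow_mul, one_div_mul_cancel hq.ne',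
        ENNReal.rpow_one]
    have e₂ : ∫⁻ y, (K x y ^ (1 / p) * ((h₂ y)⁻¹ * g y)) ^ p ∂ν =
        ∫⁻ y, K x y * ((h₂ y)⁻¹ ^ p * g y ^ p) ∂ν := by
      refine lintegral_congr fun y => ?_
      rw [ENNReal.mul_rpow_of_nonneg _ _ hp.le, ← ENNReal.rpow_mul, one_div_mul_cancel hp.ne',
        ENNReal.rpow_one, ENNReal.mul_rpow_of_nonneg _ _ hp.le]
    rw [e₁, e₂] at hH
    calc
      _ ≤ ((C * h₁ x ^ q) ^ (1 / q) *
          (∫⁻ y, K x y * ((h₂ y)⁻¹ ^ p * g y ^ p) ∂ν) ^ (1 / p)) ^ p := by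
        gcongr
        exact hH.trans (by gcongr)
      _ = _ := by
        rw [lintegral_const_mul _ (by fun_prop), ENNReal.mul_rpow_of_nonneg _ _ hp.le,
          ENNReal.mul_rpow_of_nonneg _ _ (by positivity : 0 ≤ 1 / q),
          ENNReal.mul_rpow_of_nonneg _ _ hp.le]
        simp only [← ENNReal.rpow_mul]
        rw [mul_one_div_cancel hq.ne', one_mul, one_div_mul_cancel hp.ne', ENNReal.rpow_one,
          show 1 / q * p = p / q by ring, mul_assoc]
  have hmeas : Measurable (Function.uncurry fun x y =>
      h₁ x ^ p * (K x y * ((h₂ y)⁻¹ ^ p * g y ^ p))) := by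
    have : Measurable fun a : X × Y => K a.1 a.2 := hK
    simp only [Function.uncurry_def]
    fun_prop
  calc
    _ ≤ ∫⁻ x, C ^ (p / q) * ∫⁻ y, h₁ x ^ p * (K x y * ((h₂ y)⁻¹ ^ p * g y ^ p)) ∂ν ∂μ :=
      lintegral_mono_ae step
    _ = C ^ (p / q) * ∫⁻ y, ∫⁻ x, h₁ x ^ p * (K x y * ((h₂ y)⁻¹ ^ p * g y ^ p)) ∂μ ∂ν := by
      rw [← lintegral_lintegral_swap hmeas.aemeasurable]
      exact lintegral_const_mul _ hmeas.lintegral_prod_right'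
    _ ≤ C ^ (p / q) * ∫⁻ y, C * g y ^ p ∂ν := by
      refine mul_le_mul_right (lintegral_mono_ae ?_) _
      filter_upwards [H₂, h₂_pos, h₂_fin] with y hy hy0 hyt
      have hKy : Measurable fun x => K x y := hK.comp measurable_prodMk_right
      calc
        _ = ((h₂ y)⁻¹ ^ p * g y ^ p) * ∫⁻ x, K x y * h₁ x ^ p ∂μ := by
          rw [← lintegral_const_mul _ (by fun_prop)]
          exact lintegral_congr fun x => by ring
        _ ≤ ((h₂ y)⁻¹ ^ p * g y ^ p) * (C * h₂ y ^ p) := by gcongr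
        _ = C * g y ^ p * (h₂ y * (h₂ y)⁻¹) ^ p := by
          rw [ENNReal.mul_rpow_of_nonneg _ _ hp.le]
          ring
        _ = _ := by rw [ENNReal.mul_inv_cancel hy0 hyt, ENNReal.one_rpow, mul_one]
    _ = _ := by
      rw [lintegral_const_mul _ (by fun_prop), ← mul_assoc]
      congr 1
      -- The two Schur conditions contribute `C^{p/q}` and `C`, and `p/q + 1 = p`.
      nth_rewrite 2 [← ENNReal.rpow_one C]
      rw [← ENNReal.rpow_add_of_nonneg _ _ (by positivity) zero_le_one]
      congr 1
      field_simp at hinv ⊢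
      linarith

/-! ### Haar measure and the kernel on the Heisenberg group -/

namespace Heisenberg

variable {n : ℕ}

theorem measurable_z : Measurable (z : Heisenberg n → EuclideanSpace ℂ (Fin n)) := measurable_fst

theorem measurable_t : Measurable (t : Heisenberg n → ℝ) := measurable_snd

theorem measurable_mk_comp {X : Type*} [MeasurableSpace X] {f : X → EuclideanSpace ℂ (Fin n)}
    {g : X → ℝ} (hf : Measurable f) (hg : Measurable g) :
    Measurable fun x => (mk (f x) (g x) : Heisenberg n) := hf.prodMk hg

theorem measurable_z_apply (k : Fin n) : Measurable fun w : Heisenberg n => w.z k :=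
  (EuclideanSpace.proj (𝕜 := ℂ) k).continuous.measurable.comp measurable_z

instance : MeasurableInv (Heisenberg n) where
  measurable_inv := measurable_mk_comp measurable_z.neg measurable_t.neg

instance : MeasurableMul₂ (Heisenberg n) where
  measurable_mul := by
    have h₁ := measurable_z (n := n)
    have h₂ := measurable_t (n := n)
    have h₃ := measurable_z_apply (n := n)
    refine measurable_mk_comp (f := fun x : Heisenberg n × Heisenberg n => x.1.z + x.2.z)
      (g := fun x => x.1.t + x.2.t + 2 * (∑ k, x.1.z k * starRingEnd ℂ (x.2.z k)).im) ?_ ?_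
    · fun_prop
    · have : Measurable fun x : Heisenberg n × Heisenberg n =>
          ∑ k, x.1.z k * starRingEnd ℂ (x.2.z k) := by
        refine Finset.measurable_sum _ fun k _ => ?_
        exact ((h₃ k).comp measurable_fst).mul
          (Complex.continuous_conj.measurable.comp ((h₃ k).comp measurable_snd))
      have := Complex.measurable_im.comp this
      simp only [Function.comp_def] at this
      fun_prop

instance : SFinite (haar n) := by
  unfold haar
  exact inferInstanceAs (SFinite ((4 : ℝ≥0∞) ^ n •
    (volume : Measure (EuclideanSpace ℂ (Fin n) × ℝ))))

theorem lintegral_haar {F : Heisenberg n → ℝ≥0∞} (hF : Measurable F) :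
    ∫⁻ w, F w ∂(haar n) = 4 ^ n * ∫⁻ z, ∫⁻ t : ℝ, F (mk z t) := by
  have hF' : Measurable fun x : EuclideanSpace ℂ (Fin n) × ℝ => F (mk x.1 x.2) := hF
  calc
    _ = ∫⁻ x : EuclideanSpace ℂ (Fin n) × ℝ, F (mk x.1 x.2) ∂((4 : ℝ≥0∞) ^ n • volume) := rfl
    _ = _ := by
      rw [lintegral_smul_measure, Measure.volume_eq_prod, smul_eq_mul,
        lintegral_prod _ hF'.aemeasurable]

theorem ae_z_ne_zero (hn : n ≠ 0) : ∀ᵐ w ∂(haar n), w.z ≠ 0 := by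
  have : Nonempty (Fin n) := Fin.pos_iff_nonempty.1 (Nat.pos_of_ne_zero hn)
  have h : ∀ᵐ z : EuclideanSpace ℂ (Fin n), z ≠ 0 := by simp [ae_iff]
  refine Measure.ae_smul_measure ?_ _
  exact Measure.quasiMeasurePreserving_fst.ae h

/-- In `z` the map is a reflection followed by a translation; for fixed `z` so is its action on `t`,
the symplectic term being constant there. -/
theorem measurePreserving_inv_mul (w : Heisenberg n) :
    MeasurePreserving (fun v => v⁻¹ * w) (haar n) (haar n) := by
  refine MeasurePreserving.smul_measure ?_ _
  have hm : Measurable (fun v : Heisenberg n => v⁻¹ * w) := measurable_inv.mul_const w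
  refine MeasurePreserving.skew_product
    (f := fun z : EuclideanSpace ℂ (Fin n) => -z + w.z)
    (g := fun z t => -t + w.t + 2 * (∑ k, (-z) k * starRingEnd ℂ (w.z k)).im) ?_
    (measurable_t.comp hm) (Filter.Eventually.of_forall fun z => ?_)
  · simpa only [sub_eq_neg_add] using
      Measure.measurePreserving_sub_left (volume : Measure (EuclideanSpace ℂ (Fin n))) w.z
  · simpa only [sub_eq_neg_add, add_assoc] using (Measure.measurePreserving_sub_left (volume : Measure ℝ)
      (w.t + 2 * (∑ k, (-z) k * starRingEnd ℂ (w.z k)).im)).map_eq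

theorem measurable_kernel (lam : ℝ) : Measurable (kernel n lam) := by
  have h₁ := measurable_z (n := n)
  have h₂ := measurable_t (n := n)
  unfold kernel gauge
  fun_prop

theorem kernel_nonneg (lam : ℝ) (w : Heisenberg n) : 0 ≤ kernel n lam w := by
  unfold kernel gauge
  positivity

theorem kernel_inv (lam : ℝ) (w : Heisenberg n) : kernel n lam w⁻¹ = kernel n lam w := by
  simp [kernel, gauge]

theorem kernel_eq (lam : ℝ) (w : Heisenberg n) :
    kernel n lam w = (‖w.z‖ ^ 4 + w.t ^ 2) ^ (-(lam / 4)) := by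
  rw [kernel, gauge, ← Real.rpow_mul (by positivity)]
  ring_nf

/-- The integral of the kernel along a coset of the centre. -/
theorem lintegral_kernel_mul_inv_mk {lam : ℝ} (hlam : 2 < lam) (w : Heisenberg n)
    {z' : EuclideanSpace ℂ (Fin n)} (hz : w.z ≠ z') :
    ∫⁻ t', ENNReal.ofReal (kernel n lam (w * (mk z' t')⁻¹)) =
      ENNReal.ofReal (√Real.pi * Real.Gamma (lam / 4 - 1 / 2) / Real.Gamma (lam / 4) *
        ‖w.z - z'‖ ^ (-(lam - 2))) := by
  have hpos : 0 < ‖w.z - z'‖ := norm_pos_iff.2 (sub_ne_zero.2 hz)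
  have h := lintegral_add_sq_rpow (P := ‖w.z - z'‖ ^ 4) (κ := lam / 4) (by positivity)
    (by linarith)
  -- The symplectic term depends only on `w.z` and `z'`, so a reflection and translation in `t'`
  -- absorb it.
  rw [← lintegral_sub_left_eq_self _ (w.t + 2 * (∑ k, w.z k * starRingEnd ℂ ((-z') k)).im),
    ← Real.rpow_natCast_mul hpos.le] at h
  convert h using 1
  · refine lintegral_congr fun t' => ?_
    rw [kernel_eq]
    have hnz : w.z - z' = (w * (mk z' t')⁻¹).z := by
      rw [mul_z, inv_z, sub_eq_add_neg]
      rfl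
    rw [hnz]
    congr 4
    · rw [mul_t, inv_z, inv_t]
      change w.t + -t' + 2 * (∑ k, w.z k * starRingEnd ℂ ((-z') k)).im = _
      ring
  · push_cast
    ring_nf

/-- The value of the constant in the Schur test for the Stein–Weiss kernel. -/
noncomputable def schurConst (n : ℕ) (A B : ℝ) : ℝ :=
  4 ^ n * (√Real.pi * Real.Gamma (A / 2) / Real.Gamma ((A + 1) / 2)) *
    (Real.pi ^ (n : ℝ) * (Real.Gamma (n - A) * Real.Gamma (n - B) * Real.Gamma (A + B - n)) /
      (Real.Gamma A * Real.Gamma B * Real.Gamma (2 * n - A - B)))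

/-- The centre integral lowers the exponent `2A + 2` to `2A`, after which the composition formula
applies with `D = n`, half the real dimension of `ℂⁿ`. -/
theorem lintegral_kernel_mul_norm_rpow (hn : n ≠ 0) {A B : ℝ} (hA : 0 < A) (hB : 0 < B)
    (hAn : A < n) (hBn : B < n) (hAB : n < A + B) {w : Heisenberg n} (hw : w.z ≠ 0) :
    ∫⁻ u, ENNReal.ofReal (kernel n (2 * A + 2) (w * u⁻¹) * ‖u.z‖ ^ (-(2 * B))) ∂(haar n) =
      ENNReal.ofReal (schurConst n A B * ‖w.z‖ ^ (-(2 * (A + B - n)))) := by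
  have : Nonempty (Fin n) := Fin.pos_iff_nonempty.1 (Nat.pos_of_ne_zero hn)
  have hk := measurable_kernel (n := n) (2 * A + 2)
  have hz := measurable_z (n := n)
  have h₁ := Real.Gamma_pos_of_pos (half_pos hA)
  have h₂ := Real.Gamma_pos_of_pos (show 0 < (A + 1) / 2 by positivity)
  have hrank : (n : ℝ) =
      (Module.finrank ℝ (EuclideanSpace ℂ (Fin n)) : ℝ) / 2 := by
    rw [finrank_real_of_complex]
    simp
  rw [lintegral_haar (by fun_prop)]
  calc
    _ = 4 ^ n * ∫⁻ z', ENNReal.ofReal (√Real.pi * Real.Gamma (A / 2) /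
        Real.Gamma ((A + 1) / 2)) *
          ENNReal.ofReal (‖w.z - z'‖ ^ (-(2 * A)) * ‖z'‖ ^ (-(2 * B))) := by
      congr 1
      have hne : ∀ᵐ z' : EuclideanSpace ℂ (Fin n), z' ≠ w.z := by simp [ae_iff]
      refine lintegral_congr_ae ?_
      filter_upwards [hne] with z' hz'
      have h := lintegral_kernel_mul_inv_mk (lam := 2 * A + 2) (by linarith) w hz'.symm
      simp only [ENNReal.ofReal_mul (kernel_nonneg _ _)]
      rw [show (2 * A + 2) / 4 - 1 / 2 = A / 2 by ring, show (2 * A + 2) / 4 = (A + 1) / 2 by ring,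
        show 2 * A + 2 - 2 = 2 * A by ring] at h
      have hm : Measurable fun t' => kernel n (2 * A + 2) (w * (mk z' t')⁻¹) :=
        hk.comp ((measurable_mk_comp measurable_const measurable_id).inv.const_mul w)
      rw [← ENNReal.ofReal_mul (by positivity), ← mul_assoc, ENNReal.ofReal_mul (by positivity),
        ← h]
      exact lintegral_mul_const (ENNReal.ofReal (‖z'‖ ^ (-(2 * B)))) hm.ennreal_ofReal
    _ = _ := by
      rw [lintegral_const_mul _ (by fun_prop),
        lintegral_norm_sub_rpow_mul_norm_rpow hrank hA hB hAn hBn hAB hw, ← mul_assoc,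
        show (4 : ℝ≥0∞) ^ n = ENNReal.ofReal (4 ^ n) by simp [ENNReal.ofReal_pow],
        ← ENNReal.ofReal_mul (by positivity), ← ENNReal.ofReal_mul (by positivity), schurConst]
      congr 1
      ring

end Heisenberg

/-! ### The Schur constant and the Stein–Weiss bound -/

namespace Heisenberg

variable {n : ℕ}

theorem schurConst_nonneg {A B : ℝ} (hA : 0 < A) (hB : 0 < B) (hAn : A < n) (hBn : B < n)
    (hAB : n < A + B) : 0 ≤ schurConst n A B := by
  have h₁ := Real.Gamma_pos_of_pos (half_pos hA)
  have h₂ := Real.Gamma_pos_of_pos (show 0 < (A + 1) / 2 by positivity)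
  have h₃ := Real.Gamma_pos_of_pos (sub_pos.2 hAn)
  have h₄ := Real.Gamma_pos_of_pos (sub_pos.2 hBn)
  have h₅ := Real.Gamma_pos_of_pos (sub_pos.2 hAB)
  have h₆ := Real.Gamma_pos_of_pos (show 0 < 2 * n - A - B by linarith)
  have h₇ := Real.Gamma_pos_of_pos hA
  have h₈ := Real.Gamma_pos_of_pos hB
  unfold schurConst
  positivity

/-- Replacing `B` by `2n - A - B` exchanges `n - B` with `A + B - n` and `B` with `2n - A - B`,
which only permutes the Gamma factors. This gives the two Schur conditions one constant. -/
theorem schurConst_reflect {A B B' : ℝ} (h : A + B + B' = 2 * n) :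
    schurConst n A B' = schurConst n A B := by
  obtain rfl : B' = 2 * n - A - B := by linarith
  unfold schurConst
  rw [show n - (2 * n - A - B) = A + B - n by ring, show A + (2 * n - A - B) - n = n - B by ring,
    show 2 * n - A - (2 * n - A - B) = B by ring]
  ring

/-- The Gamma factors agree; the constants differ by the factor `π^n ≥ 1`. -/
theorem schurConst_le_steinWeissConst {p q α β A B : ℝ} (hpq : 1 / p + 1 / q = 1)
    (hA : A = n - (α + β) / 2) (hB : B = n / p + β / 2) (h0 : 0 ≤ schurConst n A B) :
    schurConst n A B ≤ steinWeissConst n p q α β := by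
  have hq : n / q = n - n / p := by
    linear_combination (n : ℝ) * hpq
  have h : steinWeissConst n p q α β = Real.pi ^ n * schurConst n A B := by
    unfold steinWeissConst schurConst
    rw [hq, show (2 * n - α - β) / 4 = A / 2 by rw [hA]; ring,
      show (α + β) / 2 = n - A by rw [hA]; ring,
      show n / p - α / 2 = A + B - n by rw [hA, hB]; ring,
      show n - n / p - β / 2 = n - B by rw [hB]; ring,
      show (2 * n + 2 - α - β) / 4 = (A + 1) / 2 by rw [hA]; ring,
      show (2 * n - α - β) / 2 = A by rw [hA]; ring,
      show n - n / p + α / 2 = 2 * n - A - B by rw [hA, hB]; ring,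
      ← hB, mul_pow, ← pow_mul, mul_comm 2 n, pow_mul, Real.rpow_natCast]
    ring
  rw [h]
  exact le_mul_of_one_le_left h0 (one_le_pow₀ (by linarith [Real.pi_gt_three]))

/-- Both Schur conditions are instances: `(a, b, c)` is `(α, β, 2n/p)` for one and `(β, α, 2n/q)`
for the other. -/
theorem lintegral_weight_mul_kernel_mul_weight (hn : n ≠ 0) {A a b c : ℝ} (hA : 0 < A)
    (hAn : A < n) (hB : 0 < (b + c) / 2) (hBn : (b + c) / 2 < n) (hAB : n < A + (b + c) / 2)
    {w : Heisenberg n} (hw : w.z ≠ 0) :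
    ∫⁻ u, ENNReal.ofReal (‖w.z‖ ^ (-a) * (kernel n (2 * A + 2) (w * u⁻¹) * ‖u.z‖ ^ (-b))) *
        ENNReal.ofReal (‖u.z‖ ^ (-c)) ∂(haar n) =
      ENNReal.ofReal (schurConst n A ((b + c) / 2)) *
        ENNReal.ofReal (‖w.z‖ ^ (-(a + (2 * A + b + c - 2 * n)))) := by
  have hk := measurable_kernel (n := n) (2 * A + 2)
  have hz := measurable_z (n := n)
  have hw' : 0 < ‖w.z‖ := norm_pos_iff.2 hw
  calc
    _ = ∫⁻ u, ENNReal.ofReal (‖w.z‖ ^ (-a)) * ENNReal.ofReal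
        (kernel n (2 * A + 2) (w * u⁻¹) * ‖u.z‖ ^ (-(2 * ((b + c) / 2)))) ∂(haar n) := by
      refine lintegral_congr_ae ?_
      filter_upwards [ae_z_ne_zero hn] with u hu
      have hu' : 0 < ‖u.z‖ := norm_pos_iff.2 hu
      have h := kernel_nonneg (2 * A + 2) (w * u⁻¹)
      rw [← ENNReal.ofReal_mul (by positivity), ← ENNReal.ofReal_mul (by positivity),
        show -(2 * ((b + c) / 2)) = -b + -c by ring, Real.rpow_add hu']
      congr 1
      ring
    _ = _ := by
      rw [lintegral_const_mul _ (by fun_prop),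
        lintegral_kernel_mul_norm_rpow hn hA hB hAn hBn hAB hw,
        ← ENNReal.ofReal_mul (by positivity),
        ← ENNReal.ofReal_mul (schurConst_nonneg hA hB hAn hBn hAB), neg_add, Real.rpow_add hw',
        show -(2 * (A + (b + c) / 2 - n)) = -(2 * A + b + c - 2 * n) by ring]
      congr 1
      ring

theorem lintegral_rpow_steinWeiss_le (hn : n ≠ 0) {p q A α β : ℝ} (hpq : p.HolderConjugate q)
    (hA : A = n - (α + β) / 2) (hA0 : 0 < A) (hAn : A < n) (hα : α < 2 * n / p)
    (hβ : β < 2 * n / q) {g : Heisenberg n → ℝ≥0∞} (hg : Measurable g) :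
    ∫⁻ w, (∫⁻ u, ENNReal.ofReal (‖w.z‖ ^ (-α) *
        (kernel n (2 * A + 2) (w * u⁻¹) * ‖u.z‖ ^ (-β))) * g u ∂(haar n)) ^ p ∂(haar n) ≤
      ENNReal.ofReal (steinWeissConst n p q α β) ^ p * ∫⁻ u, g u ^ p ∂(haar n) := by
  have hp := hpq.pos
  have hq := hpq.symm.pos
  have hinv : 1 / p + 1 / q = 1 := by simpa [one_div] using hpq.inv_add_inv_eq_one
  have hk := measurable_kernel (n := n) (2 * A + 2)
  have hz := measurable_z (n := n)
  have hnq : 2 * n / q = 2 * n - 2 * n / p := by linear_combination (2 * n : ℝ) * hinv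
  -- The weight `|z|^{-2n/(pq)}` raised to the power `q` is `|z|^{-2n/p}`, and to the power `p` it
  -- is `|z|^{-2n/q}`. Combined with `|z|^{-β}` and `|z|^{-α}` these give `|z|^{-2B}` and
  -- `|z|^{-2B'}`. Positivity of `B` and `B'` uses `α + β > 0`, which is `A < n`; the other bounds
  -- are those on `α` and `β`.
  set B : ℝ := (β + 2 * n / p) / 2 with hB
  set B' : ℝ := (α + 2 * n / q) / 2 with hB'
  have hB0 : 0 < B := by linarith
  have hBn : B < n := by linarith
  have hAB : n < A + B := by linarith
  have hB0' : 0 < B' := by linarith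
  have hBn' : B' < n := by linarith
  have hAB' : n < A + B' := by linarith
  have hC0 := schurConst_nonneg hA0 hB0 hAn hBn hAB
  have hpow : ∀ (s : ℝ), 0 < s → ∀ w : Heisenberg n,
      ENNReal.ofReal (‖w.z‖ ^ (-(2 * n / (p * q)))) ^ s =
        ENNReal.ofReal (‖w.z‖ ^ (-(2 * n / (p * q) * s))) := fun s hs w => by
    rw [ENNReal.ofReal_rpow_of_nonneg (by positivity) hs.le, ← Real.rpow_mul (norm_nonneg _),
      neg_mul]
  refine (lintegral_rpow_lintegral_mul_le_of_schur hpq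
    (h₁ := fun w : Heisenberg n => ENNReal.ofReal (‖w.z‖ ^ (-(2 * n / (p * q)))))
    (h₂ := fun w : Heisenberg n => ENNReal.ofReal (‖w.z‖ ^ (-(2 * n / (p * q)))))
    (K := fun w u => ENNReal.ofReal (‖w.z‖ ^ (-α) *
        (kernel n (2 * A + 2) (w * u⁻¹) * ‖u.z‖ ^ (-β))))
    (C := ENNReal.ofReal (schurConst n A B))
    ?_ (by fun_prop) (by fun_prop) ?_ ?_ ?_ ?_ hg).trans ?_
  · simp only [Function.uncurry_def]
    fun_prop
  · filter_upwards [ae_z_ne_zero hn] with w hw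
    have : 0 < ‖w.z‖ := norm_pos_iff.2 hw
    exact (ENNReal.ofReal_pos.2 (by positivity)).ne'
  · exact Filter.Eventually.of_forall fun w => ENNReal.ofReal_ne_top
  · filter_upwards [ae_z_ne_zero hn] with w hw
    simp only [hpow q hq]
    rw [show 2 * n / (p * q) * q = 2 * n / p by field_simp,
      lintegral_weight_mul_kernel_mul_weight hn hA0 hAn hB0 hBn hAB hw, hA]
    refine le_of_eq ?_
    congr 4
    ring
  · filter_upwards [ae_z_ne_zero hn] with u hu
    simp only [hpow p hp]
    rw [show 2 * n / (p * q) * p = 2 * n / q by field_simp]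
    have h := lintegral_weight_mul_kernel_mul_weight (a := β) hn hA0 hAn hB0' hBn' hAB' hu
    -- Here `A + B + B' = 2n` because `1/p + 1/q = 1`.
    rw [← hB', schurConst_reflect (B := B) (by linarith)] at h
    refine le_of_eq ?_
    convert h using 1
    · refine lintegral_congr fun w => ?_
      -- The gauge is invariant under inversion, so the kernel is symmetric in `w` and `u`.
      rw [← kernel_inv _ (u * w⁻¹), mul_inv_rev, inv_inv]
      congr 2
      ring
    · rw [hA]
      congr 4
      ring
  · gcongr
    exact schurConst_le_steinWeissConst hinv hA (by rw [hB]; ring) hC0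

/-- The measure-preserving substitution `u = v⁻¹ w` puts the convolution in the form of an integral
operator, as Schur's test requires. -/
theorem lintegral_enorm_kernel_smul_weighted (lam β : ℝ) {f : Heisenberg n → ℂ}
    (hf : Measurable f) (w : Heisenberg n) :
    ∫⁻ v, ‖kernel n lam v • weighted β f (v⁻¹ * w)‖ₑ ∂(haar n) =
      ∫⁻ u, ENNReal.ofReal (kernel n lam (w * u⁻¹) * ‖u.z‖ ^ (-β)) * ‖f u‖ₑ ∂(haar n) := by
  have hk := measurable_kernel (n := n) lam
  have hz := measurable_z (n := n)
  rw [← (measurePreserving_inv_mul w).lintegral_comp (f := fun u =>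
    ENNReal.ofReal (kernel n lam (w * u⁻¹) * ‖u.z‖ ^ (-β)) * ‖f u‖ₑ) (by fun_prop)]
  refine lintegral_congr fun v => ?_
  rw [weighted, smul_smul, enorm_smul, Real.enorm_of_nonneg
    (mul_nonneg (kernel_nonneg _ _) (by positivity))]
  simp

theorem measurable_weighted (β : ℝ) {f : Heisenberg n → ℂ} (hf : Measurable f) :
    Measurable (weighted β f) := by
  have hz := measurable_z (n := n)
  unfold weighted
  fun_prop

theorem measurable_steinWeiss (lam α β : ℝ) {f : Heisenberg n → ℂ} (hf : Measurable f) :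
    Measurable (steinWeiss lam α β f) := by
  have hk := measurable_kernel (n := n) lam
  have hw := measurable_weighted β hf
  refine measurable_weighted α (StronglyMeasurable.measurable ?_)
  refine StronglyMeasurable.integral_prod_right (f := fun w v : Heisenberg n =>
    kernel n lam v • weighted β f (v⁻¹ * w)) (Measurable.stronglyMeasurable ?_)
  simp only [Function.uncurry_def]
  fun_prop

theorem kernel_smul_weighted_ae_congr (lam β : ℝ) {f g : Heisenberg n → ℂ}
    (h : f =ᵐ[haar n] g) (w : Heisenberg n) :
    (fun v => kernel n lam v • weighted β f (v⁻¹ * w)) =ᵐ[haar n]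
      fun v => kernel n lam v • weighted β g (v⁻¹ * w) := by
  filter_upwards [(measurePreserving_inv_mul w).quasiMeasurePreserving.ae h] with v hv
  simp only [weighted, hv]

/-- The function `M` is the operator with absolute values inside the integral. Its `L^p` bound
controls the norm by the triangle inequality, and its finiteness almost everywhere yields absolute
convergence. -/
theorem steinWeiss_bound (hn : n ≠ 0) {p q A α β : ℝ} (hpq : p.HolderConjugate q)
    (hA : A = n - (α + β) / 2) (hA0 : 0 < A) (hAn : A < n) (hα : α < 2 * n / p)
    (hβ : β < 2 * n / q) {f : Heisenberg n → ℂ} (hfm : Measurable f)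
    (hf : MemLp f (ENNReal.ofReal p) (haar n)) :
    (∀ᵐ w ∂(haar n), ConvExistsAt (kernel n (2 * A + 2)) (weighted β f) w) ∧
    MemLp (steinWeiss (2 * A + 2) α β f) (ENNReal.ofReal p) (haar n) ∧
    eLpNorm (steinWeiss (2 * A + 2) α β f) (ENNReal.ofReal p) (haar n) ≤
      ENNReal.ofReal (steinWeissConst n p q α β) * eLpNorm f (ENNReal.ofReal p) (haar n) := by
  have hp := hpq.pos
  have hk := measurable_kernel (n := n) (2 * A + 2)
  have hz := measurable_z (n := n)
  have hp0 : ENNReal.ofReal p ≠ 0 := by simpa using hp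
  have hnorm : ∀ g : Heisenberg n → ℂ, eLpNorm g (ENNReal.ofReal p) (haar n) =
      (∫⁻ w, ‖g w‖ₑ ^ p ∂(haar n)) ^ (1 / p) := fun g => by
    rw [eLpNorm_eq_lintegral_rpow_enorm_toReal hp0 ENNReal.ofReal_ne_top,
      ENNReal.toReal_ofReal hp.le]
  set M : Heisenberg n → ℝ≥0∞ := fun w => ∫⁻ u, ENNReal.ofReal (‖w.z‖ ^ (-α) *
    (kernel n (2 * A + 2) (w * u⁻¹) * ‖u.z‖ ^ (-β))) * ‖f u‖ₑ ∂(haar n) with hM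
  have hMm : Measurable M := by
    refine Measurable.lintegral_prod_right (f := fun w u : Heisenberg n =>
      ENNReal.ofReal (‖w.z‖ ^ (-α) *
        (kernel n (2 * A + 2) (w * u⁻¹) * ‖u.z‖ ^ (-β))) * ‖f u‖ₑ) ?_
    simp only [Function.uncurry_def]
    fun_prop
  have hMeq : ∀ w, M w = ENNReal.ofReal (‖w.z‖ ^ (-α)) *
      ∫⁻ v, ‖kernel n (2 * A + 2) v • weighted β f (v⁻¹ * w)‖ₑ ∂(haar n) := fun w => by
    rw [lintegral_enorm_kernel_smul_weighted _ _ hfm, ← lintegral_const_mul _ (by fun_prop), hM]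
    refine lintegral_congr fun u => ?_
    rw [ENNReal.ofReal_mul (by positivity), mul_assoc]
  have hle : ∫⁻ w, M w ^ p ∂(haar n) ≤
      ENNReal.ofReal (steinWeissConst n p q α β) ^ p * ∫⁻ u, ‖f u‖ₑ ^ p ∂(haar n) :=
    lintegral_rpow_steinWeiss_le hn hpq hA hA0 hAn hα hβ hfm.enorm
  have hfin : ∫⁻ u, ‖f u‖ₑ ^ p ∂(haar n) < ∞ := by
    have h := hf.2
    rw [hnorm] at h
    exact (ENNReal.rpow_lt_top_iff_of_pos (by positivity)).1 h
  have hMfin : ∫⁻ w, M w ^ p ∂(haar n) ≠ ∞ :=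
    (hle.trans_lt (ENNReal.mul_lt_top
      (ENNReal.rpow_lt_top_of_nonneg hp.le ENNReal.ofReal_ne_top) hfin)).ne
  have hbound : eLpNorm (steinWeiss (2 * A + 2) α β f) (ENNReal.ofReal p) (haar n) ≤
      ENNReal.ofReal (steinWeissConst n p q α β) *
        eLpNorm f (ENNReal.ofReal p) (haar n) := by
    rw [hnorm, hnorm]
    calc
      _ ≤ (∫⁻ w, M w ^ p ∂(haar n)) ^ (1 / p) := by
        gcongr with w
        rw [hMeq, steinWeiss, weighted, enorm_smul, Real.enorm_of_nonneg (by positivity)]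
        gcongr
        exact enorm_integral_le_lintegral_enorm _
      _ ≤ (ENNReal.ofReal (steinWeissConst n p q α β) ^ p *
          ∫⁻ u, ‖f u‖ₑ ^ p ∂(haar n)) ^ (1 / p) := by gcongr
      _ = _ := by
        rw [ENNReal.mul_rpow_of_nonneg _ _ (by positivity), ← ENNReal.rpow_mul,
          mul_one_div_cancel hp.ne', ENNReal.rpow_one]
  refine ⟨?_, ⟨(measurable_steinWeiss _ _ _ hfm).aestronglyMeasurable,
    hbound.trans_lt (ENNReal.mul_lt_top ENNReal.ofReal_lt_top hf.2)⟩, hbound⟩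
  filter_upwards [ae_z_ne_zero hn, ae_lt_top (hMm.pow_const p) hMfin] with w hw hMw
  have hw' : 0 < ‖w.z‖ := norm_pos_iff.2 hw
  have hMw' := (ENNReal.rpow_lt_top_iff_of_pos hp).1 hMw
  have hwm := measurable_weighted β hfm
  refine ⟨Measurable.aestronglyMeasurable (by fun_prop), ?_⟩
  rw [hMeq] at hMw'
  -- Since `w.z ≠ 0`, the outer weight is nonzero, so finiteness of `M w` passes to the convolution
  -- integral.
  exact ENNReal.lt_top_of_mul_ne_top_right hMw'.ne
    (ENNReal.ofReal_pos.2 (by positivity)).ne'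

end Heisenberg

theorem theorem9 (n : ℕ) (p q lam α β : ℝ) (hp : 1 < p) (hpq : 1 / p + 1 / q = 1)
    (hlam : 0 < lam) (hlam' : lam < 2 * n + 2) (hα : α < 2 * n / p) (hβ : β < 2 * n / q)
    (hsum : 2 * (n : ℝ) + 2 = lam + α + β)
    (f : Heisenberg n → ℂ) (hf : MemLp f (ENNReal.ofReal p) (Heisenberg.haar n)) :
    (∀ᵐ w ∂(Heisenberg.haar n),
      Heisenberg.ConvExistsAt (Heisenberg.kernel n lam) (Heisenberg.weighted β f) w) ∧
    MemLp (Heisenberg.steinWeiss lam α β f) (ENNReal.ofReal p) (Heisenberg.haar n) ∧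
    eLpNorm (Heisenberg.steinWeiss lam α β f) (ENNReal.ofReal p) (Heisenberg.haar n) ≤
      ENNReal.ofReal (Heisenberg.steinWeissConst n p q α β) *
        eLpNorm f (ENNReal.ofReal p) (Heisenberg.haar n) := by
  have hconj : p.HolderConjugate q := by
    rw [Real.holderConjugate_iff]
    exact ⟨hp, by simpa [one_div] using hpq⟩
  have hnq : 2 * n / p + 2 * n / q = 2 * (n : ℝ) := by
    linear_combination (2 * n : ℝ) * hpq
  obtain ⟨A, rfl⟩ : ∃ A, lam = 2 * A + 2 := ⟨(lam - 2) / 2, by ring⟩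
  -- The bounds on `α` and `β` add up to `α + β < 2n`, hence `lam > 2`; this is what the centre
  -- integral needs.
  have hA0 : 0 < A := by linarith
  have hAn : A < n := by linarith
  have hn : n ≠ 0 := by
    rintro rfl
    simp only [Nat.cast_zero] at hAn
    linarith
  -- Passing to a measurable representative of `f` changes the convolution at no point `w`, since `v
  -- ↦ v⁻¹ w` preserves null sets.
  have hg := hf.1.ae_eq_mk
  obtain ⟨h₁, h₂, h₃⟩ := Heisenberg.steinWeiss_bound hn hconj (A := A) (by linarith) hA0 hAn hα hβ
    hf.1.stronglyMeasurable_mk.measurable ((memLp_congr_ae hg).1 hf)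
  have hS : Heisenberg.steinWeiss (2 * A + 2) α β f =
      Heisenberg.steinWeiss (2 * A + 2) α β (hf.1.mk f) := by
    funext w
    simp only [Heisenberg.steinWeiss, Heisenberg.weighted, Heisenberg.conv]
    congr 1
    exact integral_congr_ae (Heisenberg.kernel_smul_weighted_ae_congr _ β hg w)
  rw [← eLpNorm_congr_ae hg] at h₃
  rw [hS]
  refine ⟨?_, h₂, h₃⟩
  filter_upwards [h₁] with w hw
  exact (integrable_congr (Heisenberg.kernel_smul_weighted_ae_congr _ β hg w)).2 hw
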